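/- Let $u\in\mathbb{R}^n$. If $u\neq 0$, the variation $S^-(u)$ is the number of sign changes between consecutive entries of the vector obtained from $u$ by deleting all zero entries; by convention $S^-(0)=-1$. For an integer $k\ge 0$, a matrix $X\in\mathbb{R}^{n\times m}$ is called $k$-variation bounding if $S^-(Xu)\le k$ for every $u\in\mathbb{R}^m\setminus\{0\}$ with $S^-(u)\le k$, and $k$-variation diminishing if it is $j$-variation bounding for every $j\in\{0,\dots,k\}$. For $1\le k\le\min\{n,m\}$, $X$ is called $k$-sign consistent if its $k\times k$ minors are all nonnegative or all nonpositive (that is, its $k$-th multiplicative compound matrix is entrywise nonnegative or entrywise nonpositive), and $k$-sign regular if it is $j$-sign consistent for every $j\in\{1,\dots,k\}$. **Corollary.** Let $k\ge 1$ and let $X\in\mathbb{R}^{n\times m}$ have $\operatorname{rank}(X)>k$ and be such that any $k$ columns of $X$ are linearly independent. Then $X$ is $(k-1)$-variation diminishing if and only if $X$ is $k$-sign regular. -/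

import Mathlib

/-- The vector `u` with all its zero entries deleted, as a list. -/
noncomputable def deleteZeros {n : ℕ} (u : Fin n → ℝ) : List ℝ :=
  (List.ofFn u).filter (fun x => decide (x ≠ 0))

/-- The number of indices `i` for which the consecutive entries `l i` and `l (i + 1)` have a
negative product. -/
noncomputable def countSignChanges (l : List ℝ) : ℕ :=
  (List.zipWith (fun a b : ℝ => if a * b < 0 then 1 else 0) l l.tail).sum

/-- The variation of a real vector: the number of sign changes in the vector that is left when all
zeros are deleted, with the convention that the zero vector has variation `-1`. -/
noncomputable def variation {n : ℕ} (u : Fin n → ℝ) : ℤ :=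
  if u = 0 then -1 else (countSignChanges (deleteZeros u) : ℤ)

/-- `X` is `k`-variation bounding: it maps nonzero vectors of variation at most `k` to vectors of
variation at most `k`. -/
def IsVariationBounding {n m : ℕ} (k : ℕ) (X : Matrix (Fin n) (Fin m) ℝ) : Prop :=
  ∀ u : Fin m → ℝ, u ≠ 0 → variation u ≤ (k : ℤ) → variation (X.mulVec u) ≤ (k : ℤ)

/-- `X` is `k`-variation diminishing: it is `j`-variation bounding for all `j ∈ {0, …, k}`. -/
def IsVariationDiminishing {n m : ℕ} (k : ℕ) (X : Matrix (Fin n) (Fin m) ℝ) : Prop :=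
  ∀ j : ℕ, j ≤ k → IsVariationBounding j X

/-- The `r`-th multiplicative compound matrix: its entries are the minors of order `r`. Rows and
columns are indexed by the strictly increasing `r`-tuples of row and column indices themselves,
rather than by the positions of these tuples in the lexicographic order. -/
def compoundMatrix {n m : ℕ} (r : ℕ) (X : Matrix (Fin n) (Fin m) ℝ) :
    Matrix (Fin r ↪o Fin n) (Fin r ↪o Fin m) ℝ :=
  Matrix.of fun I J => (X.submatrix I J).det

/-- `X` is `k`-sign consistent: its `k`-th compound matrix is entrywise nonnegative or entrywise
nonpositive. -/
def IsSignConsistent {n m : ℕ} (k : ℕ) (X : Matrix (Fin n) (Fin m) ℝ) : Prop :=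
  (∀ I J, 0 ≤ compoundMatrix k X I J) ∨ (∀ I J, compoundMatrix k X I J ≤ 0)

/-- `X` is `k`-sign regular: it is `j`-sign consistent for all `j ∈ {1, …, k}`. -/
def IsSignRegular {n m : ℕ} (k : ℕ) (X : Matrix (Fin n) (Fin m) ℝ) : Prop :=
  ∀ j : ℕ, 1 ≤ j → j ≤ k → IsSignConsistent j X

/-! The equivalence holds order by order: for each `j ≤ k`, being `(j - 1)`-variation bounding is
the same as being `j`-sign consistent. The hypotheses pass from `k` to `j`, since any `j` columns
extend to `k` columns.

Both directions rest on one relation. For `Y` with `k` columns, `z = Y c` and `k + 1` rows `R`, the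
sum of `(-1) ^ r * z (R r)` times the maximal minor on the rows `R` without `R r` vanishes
(`sum_alternating_mul_minor_eq_zero`).

From signs of minors to variation: a vector with fewer than `k` sign changes is, up to a small
perturbation, `M c`, where the `k` columns of `M` are positive on consecutive blocks. The maximal
minors of `X * M` are nonnegative combinations of minors of `X`, so they have one sign. If `X * M *
c` alternated on `k + 1` rows, all terms of the relation would have one sign; vanishing minors are
removed by a further perturbation (`not_hasAlternation_of_minors_nonneg`).

From variation to signs of minors: for a fixed set of `k` columns, the relation and basis exchange
among the rows give the minors one sign (`minor_mul_minor_nonneg`). Two column sets that omit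
neighbouring members of `k + 1` independent columns are compared by merging these two columns with
nonnegative weights (`minorsAgree_castSucc_succ`). Exchanges then connect all column sets, and rank
above `k` allows a detour around dependent unions (`minorsAgree_of_bounding`). -/

/-! ### Sign changes, alternating entries and blocks of one sign -/

/-- `z` has `k + 1` entries, at increasing positions, whose signs strictly alternate. -/
def HasAlternation {n : ℕ} (k : ℕ) (z : Fin n → ℝ) : Prop :=
  ∃ (σ : ℝ) (i : Fin (k + 1) → Fin n), StrictMono i ∧ ∀ r : Fin (k + 1), 0 < σ * (-1) ^ (r : ℕ) * z (i r)

/-- `g` splits the positions of `u` into consecutive blocks, numbered from `0`, on which the sign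
of `u` weakly alternates, starting with the sign of `σ`. -/
structure IsGrouping {n : ℕ} (σ : ℝ) (u : Fin n → ℝ) (g : Fin n → ℕ) : Prop where
  start : ∀ j : Fin n, j.val = 0 → g j = 0
  step : ∀ j j' : Fin n, j'.val = j.val + 1 → g j ≤ g j' ∧ g j' ≤ g j + 1
  sign : ∀ j, 0 ≤ σ * (-1) ^ g j * u j

theorem IsGrouping.monotone {n : ℕ} {σ : ℝ} {u : Fin n → ℝ} {g : Fin n → ℕ}
    (h : IsGrouping σ u g) : Monotone g := by
  cases n with
  | zero => exact fun a => a.elim0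
  | succ n => exact Fin.monotone_iff_le_succ.2 fun i => (h.step _ _ (by simp)).1

theorem deleteZeros_succ {n : ℕ} (u : Fin (n + 1) → ℝ) :
    deleteZeros u = if u 0 = 0 then deleteZeros (fun j => u j.succ)
      else u 0 :: deleteZeros (fun j => u j.succ) := by
  unfold deleteZeros
  rw [List.ofFn_succ, List.filter_cons]
  by_cases h : u 0 = 0 <;> simp [h]

theorem deleteZeros_eq_nil_iff {n : ℕ} (u : Fin n → ℝ) : deleteZeros u = [] ↔ u = 0 := by
  simp only [deleteZeros, List.filter_eq_nil_iff, List.mem_ofFn, funext_iff]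
  simp

theorem countSignChanges_cons_cons (a b : ℝ) (l : List ℝ) :
    countSignChanges (a :: b :: l) = (if a * b < 0 then 1 else 0) + countSignChanges (b :: l) := by
  simp [countSignChanges]

/-- A nonzero vector with `v` sign changes can be grouped into `v + 1` blocks and has `v + 1`
alternating entries. -/
theorem exists_grouping_and_alternation {n : ℕ} (u : Fin n → ℝ) (hu : u ≠ 0) :
    ∃ σ : ℝ, (σ = 1 ∨ σ = -1) ∧ (∀ h t, deleteZeros u = h :: t → 0 < σ * h) ∧
      (∃ g : Fin n → ℕ, IsGrouping σ u g ∧ ∀ j, g j ≤ countSignChanges (deleteZeros u)) ∧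
      ∃ i : Fin (countSignChanges (deleteZeros u) + 1) → Fin n, StrictMono i ∧
        ∀ r : Fin (countSignChanges (deleteZeros u) + 1), 0 < σ * (-1) ^ (r : ℕ) * u (i r) := by
  -- The clause on the head of `deleteZeros u` serves the induction: `σ` is the sign of the first
  -- nonzero entry, which decides whether a prepended entry joins the first block or opens a new one
  -- with sign `-σ`.
  induction n with
  | zero => exact absurd (Subsingleton.elim _ _) hu
  | succ n ih =>
    set u' : Fin n → ℝ := fun j => u j.succ with hu'
    by_cases h0 : u 0 = 0
    · have hne : u' ≠ 0 := by
        intro h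
        apply hu
        funext j
        refine Fin.cases h0 (fun j => congrFun h j) j
      obtain ⟨σ, hσ, hh, ⟨g, hg, hgb⟩, i, hi, hia⟩ := ih u' hne
      have hd : deleteZeros u = deleteZeros u' := by rw [deleteZeros_succ, if_pos h0]
      rw [hd]
      refine ⟨σ, hσ, hh, ⟨Fin.cons 0 g, ⟨?_, ?_, ?_⟩, ?_⟩, fun r => (i r).succ, ?_, hia⟩
      · intro j hj
        have : j = 0 := Fin.ext hj
        subst this; rfl
      · intro j j'
        refine Fin.cases ?_ (fun j' => ?_) j'
        · intro h; simp at h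
        · refine Fin.cases ?_ (fun j => ?_) j
          · intro h
            have := hg.start j' (by simpa using h)
            simp [this]
          · intro h
            simpa using hg.step j j' (by simpa using h)
      · intro j
        refine Fin.cases ?_ (fun j => ?_) j
        · simp [h0]
        · simpa using hg.sign j
      · intro j
        refine Fin.cases ?_ (fun j => ?_) j
        · simp
        · simpa using hgb j
      · exact fun a b hab => Fin.succ_lt_succ_iff.2 (hi hab)
    · have hd : deleteZeros u = u 0 :: deleteZeros u' := by rw [deleteZeros_succ, if_neg h0]
      by_cases hz : u' = 0
      · have hdn : deleteZeros u = [u 0] := by rw [hd, (deleteZeros_eq_nil_iff u').2 hz]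
        have hc : countSignChanges (deleteZeros u) = 0 := by rw [hdn]; simp [countSignChanges]
        obtain ⟨σ, hσ, hp⟩ : ∃ σ : ℝ, (σ = 1 ∨ σ = -1) ∧ 0 < σ * u 0 := by
          rcases lt_or_gt_of_ne h0 with h | h
          · exact ⟨-1, Or.inr rfl, by linarith⟩
          · exact ⟨1, Or.inl rfl, by linarith⟩
        refine ⟨σ, hσ, ?_, ⟨fun _ => 0, ⟨fun _ _ => rfl, fun _ _ _ => ⟨le_rfl, by simp⟩, ?_⟩,
          fun _ => by simp⟩, fun _ => 0, ?_, ?_⟩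
        · intro h t e
          rw [hdn] at e
          obtain ⟨rfl, -⟩ := List.cons.inj e
          exact hp
        · intro j
          refine Fin.cases ?_ (fun j => ?_) j
          · simpa using hp.le
          · have : u j.succ = 0 := congrFun hz j
            simp [this]
        · intro a b hab
          rw [Fin.lt_def] at hab
          omega
        · intro r
          have : (r : ℕ) = 0 := by omega
          simpa [this] using hp
      · obtain ⟨σ, hσ, hh, ⟨g, hg, hgb⟩, i, hi, hia⟩ := ih u' hz
        obtain ⟨h, t, ht⟩ : ∃ h t, deleteZeros u' = h :: t :=
          List.exists_cons_of_ne_nil (fun e => hz ((deleteZeros_eq_nil_iff u').1 e))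
        have hσh := hh h t ht
        have hh0 : h ≠ 0 := by rintro rfl; simp at hσh
        have hcnt : countSignChanges (deleteZeros u) =
            (if u 0 * h < 0 then 1 else 0) + countSignChanges (deleteZeros u') := by
          rw [hd, ht, countSignChanges_cons_cons]
        by_cases hs : u 0 * h < 0
        · rw [if_pos hs] at hcnt
          have hp : 0 < -σ * u 0 := by
            rcases hσ with rfl | rfl <;> nlinarith
          refine ⟨-σ, ?_, ?_, ⟨Fin.cons 0 (fun j => g j + 1), ⟨?_, ?_, ?_⟩, ?_⟩, ?_⟩
          · rcases hσ with rfl | rfl <;> simp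
          · intro a l e
            rw [hd] at e
            obtain ⟨rfl, -⟩ := List.cons.inj e
            exact hp
          · intro j hj
            have : j = 0 := Fin.ext hj
            subst this; rfl
          · intro j j'
            refine Fin.cases ?_ (fun j' => ?_) j'
            · intro h; simp at h
            · refine Fin.cases ?_ (fun j => ?_) j
              · intro h
                have := hg.start j' (by simpa using h)
                simp [this]
              · intro h
                simpa using hg.step j j' (by simpa using h)
          · intro j
            refine Fin.cases ?_ (fun j => ?_) j
            · simpa using hp.le
            · have := hg.sign j
              simp only [Fin.cons_succ, pow_succ]
              simp only [hu'] at this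
              linarith
          · intro j
            rw [hcnt]
            refine Fin.cases ?_ (fun j => ?_) j
            · simp
            · have := hgb j
              simp only [Fin.cons_succ]
              omega
          · rw [hcnt, add_comm 1]
            refine ⟨Fin.cons 0 (fun r => (i r).succ), ?_, ?_⟩
            · rw [Fin.strictMono_iff_lt_succ]
              intro r
              refine Fin.cases ?_ (fun r => ?_) r
              · simp
              · rw [← Fin.succ_castSucc]
                simp only [Fin.cons_succ, Fin.succ_lt_succ_iff]
                exact hi (Fin.castSucc_lt_succ)
            · intro r
              refine Fin.cases ?_ (fun r => ?_) r
              · simpa using hp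
              · have := hia r
                simp only [Fin.cons_succ, Fin.val_succ, pow_succ]
                simp only [hu'] at this
                linarith
        · rw [if_neg hs, zero_add] at hcnt
          have hpos : 0 < u 0 * h := lt_of_le_of_ne (not_lt.1 hs) (Ne.symm (mul_ne_zero h0 hh0))
          have hp : 0 < σ * u 0 := by
            rcases hσ with rfl | rfl <;> nlinarith
          rw [hcnt]
          refine ⟨σ, hσ, ?_, ⟨Fin.cons 0 g, ⟨?_, ?_, ?_⟩, ?_⟩, fun r => (i r).succ, ?_, hia⟩
          · intro a l e
            rw [hd] at e
            obtain ⟨rfl, -⟩ := List.cons.inj e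
            exact hp
          · intro j hj
            have : j = 0 := Fin.ext hj
            subst this; rfl
          · intro j j'
            refine Fin.cases ?_ (fun j' => ?_) j'
            · intro h; simp at h
            · refine Fin.cases ?_ (fun j => ?_) j
              · intro h
                have := hg.start j' (by simpa using h)
                simp [this]
              · intro h
                simpa using hg.step j j' (by simpa using h)
          · intro j
            refine Fin.cases ?_ (fun j => ?_) j
            · simpa using hp.le
            · simpa using hg.sign j
          · intro j
            refine Fin.cases ?_ (fun j => ?_) j
            · simp
            · simpa using hgb j
          · exact fun a b hab => Fin.succ_lt_succ_iff.2 (hi hab)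

/-- Consecutive alternating entries have opposite strict signs, so they cannot share a block; the
block numbers increase strictly along the alternation. -/
theorem HasAlternation.le_of_grouping {n k : ℕ} {z : Fin n → ℝ} (h : HasAlternation k z)
    {g : Fin n → ℕ} (hg : Monotone g) {c : ℕ → ℝ}
    (hs : ∀ j, 0 ≤ c (g j) * z j) (hc : ∀ i, c i ≠ 0) {v : ℕ} (hv : ∀ j, g j ≤ v) : k ≤ v := by
  obtain ⟨σ, i, hi, ha⟩ := h
  have hmono : StrictMono (g ∘ i) := by
    rw [Fin.strictMono_iff_lt_succ]
    intro r
    refine lt_of_le_of_ne (hg (hi Fin.castSucc_lt_succ).le) fun e => ?_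
    simp only [Function.comp] at e
    have h1 := ha r.castSucc
    have h2 := ha r.succ
    have h3 := hs (i r.castSucc)
    have h4 := hs (i r.succ)
    rw [← e] at h4
    have hz1 : z (i r.castSucc) ≠ 0 := by intro h; simp [h] at h1
    have hz2 : z (i r.succ) ≠ 0 := by intro h; simp [h] at h2
    have hc' := hc (g (i r.castSucc))
    have h3' := lt_of_le_of_ne h3 (Ne.symm (mul_ne_zero hc' hz1))
    have h4' := lt_of_le_of_ne h4 (Ne.symm (mul_ne_zero hc' hz2))
    have h5 := mul_pos h3' h4'
    have h6 := mul_pos h1 h2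
    simp only [Fin.val_succ, Fin.val_castSucc, pow_succ] at h6
    have h7 : 0 ≤ (c (g (i r.castSucc))) ^ 2 := sq_nonneg _
    have h8 : 0 ≤ (σ * (-1) ^ (r : ℕ)) ^ 2 := sq_nonneg _
    have h9 : 0 < z (i r.castSucc) * z (i r.succ) := by
      by_contra hcon
      have := mul_nonneg h7 (neg_nonneg.2 (not_lt.1 hcon))
      linarith
    have := mul_nonneg h8 h9.le
    linarith
  have hle : ∀ r : Fin (k + 1), (r : ℕ) ≤ g (i r) := by
    intro r
    induction r using Fin.induction with
    | zero => simp
    | succ r ih => exact Nat.succ_le_of_lt (lt_of_le_of_lt ih (hmono Fin.castSucc_lt_succ))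
  simpa using (hle (Fin.last k)).trans (hv _)

theorem hasAlternation_of_le_variation {n k : ℕ} {z : Fin n → ℝ} (h : (k : ℤ) ≤ variation z) :
    HasAlternation k z := by
  unfold variation at h
  split_ifs at h with hz
  · omega
  · obtain ⟨σ, -, -, -, i, hi, hia⟩ := exists_grouping_and_alternation z hz
    have hk : k ≤ countSignChanges (deleteZeros z) := by exact_mod_cast h
    exact ⟨σ, fun r => i (Fin.castLE (by omega) r),
      fun a b hab => hi (Fin.strictMono_castLE _ hab), fun r => hia (Fin.castLE _ r)⟩

/-- Replaces counting by a condition that is open in `z` and also covers `z = 0`. -/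
theorem variation_lt_iff {n k : ℕ} (z : Fin n → ℝ) :
    variation z < (k : ℤ) ↔ ¬ HasAlternation k z := by
  constructor
  · intro h ha
    have hz : z ≠ 0 := by
      rintro rfl
      obtain ⟨σ, i, -, hi⟩ := ha
      simpa using hi 0
    obtain ⟨σ, hσ, -, ⟨g, hg, hb⟩, -⟩ := exists_grouping_and_alternation z hz
    have hle := ha.le_of_grouping hg.monotone (c := fun i => σ * (-1) ^ i) hg.sign
      (fun i => by rcases hσ with rfl | rfl <;> simp) hb
    unfold variation at h
    rw [if_neg hz] at h
    omega
  · intro h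
    by_contra hcon
    exact h (hasAlternation_of_le_variation (not_lt.1 hcon))

-- An alternation is a finite set of strict inequalities, hence survives small perturbations.
-- Contrapositively, its absence passes to limits.
open Filter Topology in
theorem HasAlternation.eventually {α : Type*} {n k : ℕ} {z : Fin n → ℝ} (h : HasAlternation k z)
    {l : Filter α} {f : α → Fin n → ℝ} (hf : Tendsto f l (𝓝 z)) :
    ∀ᶠ t in l, HasAlternation k (f t) := by
  obtain ⟨σ, i, hi, ha⟩ := h
  have : ∀ᶠ t in l, ∀ r : Fin (k + 1), 0 < σ * (-1) ^ (r : ℕ) * f t (i r) := by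
    rw [eventually_all]
    intro r
    exact (((tendsto_pi_nhds.1 hf (i r)).const_mul _).eventually_const_lt (ha r))
  exact this.mono fun t ht => ⟨σ, i, hi, ht⟩

/-! ### Matrices with `k` columns whose maximal minors have one sign -/

/-- The linear relation between the entries of `Y c` at `k + 1` rows, with the complementary minors
as coefficients. -/
theorem sum_alternating_mul_minor_eq_zero {n k : ℕ} (Y : Matrix (Fin n) (Fin k) ℝ)
    (R : Fin (k + 1) → Fin n) (c : Fin k → ℝ) :
    ∑ r : Fin (k + 1), (-1) ^ (r : ℕ) * (Y.mulVec c) (R r) *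
      (Y.submatrix (R ∘ r.succAbove) id).det = 0 := by
  set A : Matrix (Fin (k + 1)) (Fin (k + 1)) ℝ :=
    Matrix.of fun r => Fin.cons ((Y.mulVec c) (R r)) (fun j => Y (R r) j) with hA
  -- The first column of `A` is a combination of the others; expanding along it gives the relation.
  have hdet : A.det = 0 := by
    rw [← Matrix.exists_mulVec_eq_zero_iff]
    refine ⟨Fin.cons (-1) c, fun h => ?_, ?_⟩
    · have := congrFun h 0
      simp at this
    · funext r
      simp [A, Matrix.mulVec, dotProduct, Fin.sum_univ_succ]
  rw [Matrix.det_succ_column_zero] at hdet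
  rw [← hdet]
  refine Finset.sum_congr rfl fun r _ => ?_
  congr 1

/-- An alternation would make every term of the vanishing sum strictly of the same sign. -/
theorem not_hasAlternation_of_minors_pos {n k : ℕ} (Y : Matrix (Fin n) (Fin k) ℝ) (ε : ℝ)
    (hY : ∀ L : Fin k → Fin n, StrictMono L → 0 < ε * (Y.submatrix L id).det) (c : Fin k → ℝ) :
    ¬ HasAlternation k (Y.mulVec c) := by
  rintro ⟨σ, i, hi, ha⟩
  have h := sum_alternating_mul_minor_eq_zero Y i c
  have hpos : 0 < ∑ r : Fin (k + 1), (σ * (-1) ^ (r : ℕ) * (Y.mulVec c) (i r)) *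
      (ε * (Y.submatrix (i ∘ r.succAbove) id).det) :=
    Finset.sum_pos (fun r _ => mul_pos (ha r) (hY _ (hi.comp (Fin.strictMono_succAbove r))))
      Finset.univ_nonempty
  have he : ∑ r : Fin (k + 1), (σ * (-1) ^ (r : ℕ) * (Y.mulVec c) (i r)) *
      (ε * (Y.submatrix (i ∘ r.succAbove) id).det) = (σ * ε) * ∑ r : Fin (k + 1),
      (-1) ^ (r : ℕ) * (Y.mulVec c) (i r) * (Y.submatrix (i ∘ r.succAbove) id).det := by
    rw [Finset.mul_sum]
    exact Finset.sum_congr rfl fun r _ => by ring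
  rw [he, h, mul_zero] at hpos
  exact lt_irrefl _ hpos

theorem StrictMono.update_of_adjacent {n k : ℕ} {K : Fin k → Fin n} (hK : StrictMono K)
    {q : Fin k} {a : Fin n} (hadj : a.val = (K q).val + 1 ∨ (K q).val = a.val + 1)
    (ha : a ∉ Set.range K) : StrictMono (Function.update K q a) := by
  intro i j hij
  have hne : ∀ i, (K i).val ≠ a.val := fun i h => ha ⟨i, Fin.ext h⟩
  have hKij := hK hij
  rw [Fin.lt_def] at hKij ⊢
  by_cases hi : i = q
  · subst hi
    rw [Function.update_self, Function.update_of_ne hij.ne']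
    have := hne j
    omega
  · by_cases hj : j = q
    · subst hj
      rw [Function.update_self, Function.update_of_ne hij.ne]
      have := hne i
      omega
    · rwa [Function.update_of_ne hi, Function.update_of_ne hj]

theorem StrictMono.val_le_fin {n k : ℕ} {L : Fin k → Fin n} (hL : StrictMono L) (i : Fin k) :
    i.val ≤ (L i).val := by
  obtain ⟨i, hi⟩ := i
  induction i with
  | zero => simp
  | succ i ih =>
    have h1 := ih (by omega)
    have h2 : L ⟨i, by omega⟩ < L ⟨i + 1, hi⟩ := hL (by simp [Fin.lt_def])
    rw [Fin.lt_def] at h2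
    simp only at h1 ⊢
    omega

/-- Any two increasing tuples are connected by moves that change one entry by one. -/
theorem forall_strictMono_of_adjacent_moves {n k : ℕ} {P : (Fin k → Fin n) → Prop}
    (hP : ∀ (L : Fin k → Fin n) (p : Fin k) (b : Fin n), StrictMono L →
      (b.val = (L p).val + 1 ∨ (L p).val = b.val + 1) → StrictMono (Function.update L p b) →
      P L → P (Function.update L p b))
    {L₀ : Fin k → Fin n} (h₀ : StrictMono L₀) (hL₀ : P L₀) (L : Fin k → Fin n)
    (hL : StrictMono L) : P L := by
  have hkn : k ≤ n := by simpa using Fintype.card_le_of_injective _ h₀.injective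
  -- Every tuple descends to the least one, `0, …, k - 1`, by lowering the first entry that is not
  -- minimal; the sum of the entries decreases. Moves are reversible, hence the equivalence.
  have key : ∀ (s : ℕ) (L : Fin k → Fin n), StrictMono L → ∑ i, (L i).val = s →
      (P L ↔ P (Fin.castLE hkn)) := by
    intro s
    induction s using Nat.strong_induction_on with
    | _ s ih =>
      intro L hL hs
      by_cases hmin : ∀ i, (L i).val = i.val
      · have : L = Fin.castLE hkn := funext fun i => Fin.ext (hmin i)
        rw [this]
      · push Not at hmin
        obtain ⟨p, hp, hpm⟩ : ∃ p, (L p).val ≠ p.val ∧ ∀ q < p, (L q).val = q.val := by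
          obtain ⟨p, hp, hpm⟩ := WellFounded.has_min (wellFounded_lt (α := Fin k))
            {p | (L p).val ≠ p.val} hmin
          exact ⟨p, hp, fun q hq => by by_contra h; exact hpm q h hq⟩
        have hple := hL.val_le_fin p
        set b : Fin n := ⟨(L p).val - 1, by omega⟩ with hb
        have hadj : (L p).val = b.val + 1 := by simp only [hb]; omega
        have hbr : b ∉ Set.range L := by
          rintro ⟨q, hq⟩
          have hlt : q < p := by
            rw [← hL.lt_iff_lt, Fin.lt_def, hq]; omega
          have h1 := hpm q hlt
          rw [hq] at h1
          rw [Fin.lt_def] at hlt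
          omega
        have hU := hL.update_of_adjacent (Or.inr hadj) hbr
        have hsum : ∑ i, (Function.update L p b i).val < s := by
          rw [← hs]
          refine Finset.sum_lt_sum (fun i _ => ?_) ⟨p, Finset.mem_univ _, ?_⟩
          · by_cases hi : i = p
            · subst hi; rw [Function.update_self]; omega
            · rw [Function.update_of_ne hi]
          · rw [Function.update_self]; omega
        rw [← ih _ hsum _ hU rfl]
        refine ⟨hP L p b hL (Or.inr hadj) hU, fun h => ?_⟩
        have := hP _ p (L p) hU (by rw [Function.update_self]; exact Or.inl hadj)
          (by simpa using hL) h
        simpa using this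
  exact (key _ L hL rfl).2 ((key _ L₀ h₀ rfl).1 hL₀)

theorem Matrix.submatrix_updateRow_of_notMem {n k : ℕ} (Y : Matrix (Fin n) (Fin k) ℝ) {b : Fin n}
    (v : Fin k → ℝ) {K : Fin k → Fin n} (hb : b ∉ Set.range K) :
    (Y.updateRow b v).submatrix K id = Y.submatrix K id := by
  ext i j
  have : K i ≠ b := fun h => hb ⟨i, h⟩
  simp [Matrix.updateRow_apply, this]

theorem Matrix.det_submatrix_updateRow_add {n k : ℕ} (Y : Matrix (Fin n) (Fin k) ℝ) (a : Fin n)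
    (t : ℝ) {K : Fin k → Fin n} (hK : Function.Injective K) (q : Fin k) :
    ((Y.updateRow (K q) (Y (K q) + t • Y a)).submatrix K id).det =
      (Y.submatrix K id).det + t * (Y.submatrix (Function.update K q a) id).det := by
  have h1 : (Y.updateRow (K q) (Y (K q) + t • Y a)).submatrix K id =
      (Y.submatrix K id).updateRow q (Y (K q) + t • Y a) := by
    ext i j
    by_cases h : i = q
    · subst h; simp
    · simp [Matrix.updateRow_apply, h, hK.ne h]
  have h2 : (Y.submatrix K id).updateRow q (Y (K q)) = Y.submatrix K id := by
    ext i j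
    by_cases h : i = q
    · subst h; simp
    · simp [Matrix.updateRow_apply, h]
  have h3 : (Y.submatrix K id).updateRow q (Y a) = Y.submatrix (Function.update K q a) id := by
    ext i j
    by_cases h : i = q
    · subst h; simp
    · simp [Matrix.updateRow_apply, h]
  rw [h1, Matrix.det_updateRow_add, Matrix.det_updateRow_smul, h2, h3]

open Classical in
open Filter Topology in
/-- If the maximal minors of `Y` are all of one sign and do not all vanish, the vectors in the
range of `Y` have fewer than `k` sign changes. -/
theorem not_hasAlternation_of_minors_nonneg {n k : ℕ} (ε : ℝ) (Y : Matrix (Fin n) (Fin k) ℝ)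
    (hY : ∀ L : Fin k → Fin n, StrictMono L → 0 ≤ ε * (Y.submatrix L id).det)
    {L₀ : Fin k → Fin n} (h₀ : StrictMono L₀) (hL₀ : ε * (Y.submatrix L₀ id).det ≠ 0)
    (c : Fin k → ℝ) : ¬ HasAlternation k (Y.mulVec c) := by
  set zeros : Matrix (Fin n) (Fin k) ℝ → Finset (Fin k → Fin n) := fun Y =>
    Finset.univ.filter fun L => StrictMono L ∧ ε * (Y.submatrix L id).det = 0 with hzeros
  induction hN : (zeros Y).card using Nat.strong_induction_on generalizing Y with
  | _ N ih =>
    by_cases hall : ∀ L : Fin k → Fin n, StrictMono L → ε * (Y.submatrix L id).det ≠ 0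
    · exact not_hasAlternation_of_minors_pos Y ε
        (fun L hL => lt_of_le_of_ne (hY L hL) (hall L hL).symm) c
    -- If nonvanishing were preserved by all adjacent moves, no minor would vanish. So some move
    -- between neighbouring rows `a` and `b` leads from a nonzero minor to a zero one.
    have hmove : ¬ ∀ (L : Fin k → Fin n) (p : Fin k) (b : Fin n), StrictMono L →
        (b.val = (L p).val + 1 ∨ (L p).val = b.val + 1) → StrictMono (Function.update L p b) →
        ε * (Y.submatrix L id).det ≠ 0 →
        ε * (Y.submatrix (Function.update L p b) id).det ≠ 0 := fun h =>
      hall fun L hL => forall_strictMono_of_adjacent_moves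
        (P := fun L => ε * (Y.submatrix L id).det ≠ 0) h h₀ hL₀ L hL
    push Not at hmove
    obtain ⟨L, p, b, hL, hadj, hU, hLne, hUz⟩ := hmove
    set a := L p with ha
    -- Adding `t` times row `a` to row `b` adds to each minor through `b` the `t`-fold minor with
    -- `a` in place of `b`. As `a` and `b` are adjacent, that tuple is again increasing, or it
    -- repeats `a` and the minor is zero.
    have hmono : ∀ t : ℝ, 0 ≤ t → ∀ K : Fin k → Fin n, StrictMono K →
        ε * (Y.submatrix K id).det ≤
          ε * ((Y.updateRow b (Y b + t • Y a)).submatrix K id).det := by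
      intro t ht K hK
      by_cases hb : b ∈ Set.range K
      · obtain ⟨q, rfl⟩ := hb
        rw [Matrix.det_submatrix_updateRow_add Y a t hK.injective q, mul_add]
        have : 0 ≤ ε * (t * (Y.submatrix (Function.update K q a) id).det) := by
          by_cases haK : a ∈ Set.range K
          · obtain ⟨q', hq'⟩ := haK
            have hne : q' ≠ q := by
              rintro rfl
              rw [hq'] at hadj
              omega
            rw [Matrix.det_zero_of_row_eq hne (M := Y.submatrix (Function.update K q a) id)]
            · simp
            · funext j
              simp [Function.update_of_ne hne, hq']
          · have := hY _ (hK.update_of_adjacent hadj.symm haK)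
            rw [mul_left_comm]
            exact mul_nonneg ht this
        linarith
      · rw [Matrix.submatrix_updateRow_of_notMem _ _ hb]
    have hnot : ∀ t : ℝ, 0 < t →
        ¬ HasAlternation k ((Y.updateRow b (Y b + t • Y a)).mulVec c) := by
      intro t ht
      refine ih _ ?_ _ (fun K hK => (hY K hK).trans (hmono t ht.le K hK)) ?_ rfl
      · rw [← hN]
        refine Finset.card_lt_card ⟨fun K hK => ?_, fun hsub => ?_⟩
        · simp only [hzeros, Finset.mem_filter, Finset.mem_univ, true_and] at hK ⊢
          refine ⟨hK.1, le_antisymm ?_ (hY K hK.1)⟩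
          rw [← hK.2]
          exact hmono t ht.le K hK.1
        · have hmem : Function.update L p b ∈ zeros Y := by
            simp only [hzeros, Finset.mem_filter, Finset.mem_univ, true_and]
            exact ⟨hU, hUz⟩
          have := hsub hmem
          simp only [hzeros, Finset.mem_filter, Finset.mem_univ, true_and] at this
          have h2 := this.2
          have h3 := Matrix.det_submatrix_updateRow_add Y a t hU.injective p
          rw [Function.update_self] at h3
          rw [h3, mul_add, hUz, zero_add, Function.update_idem, ha, Function.update_eq_self,
            mul_left_comm] at h2
          exact (mul_ne_zero ht.ne' hLne) h2
      · have h1 := hY L₀ h₀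
        have h2 := hmono t ht.le L₀ h₀
        exact (lt_of_lt_of_le (lt_of_le_of_ne h1 hL₀.symm) h2).ne'
    intro hA
    have hcont : Continuous fun t : ℝ => (Y.updateRow b (Y b + t • Y a)).mulVec c := by
      refine Continuous.matrix_mulVec (Continuous.matrix_updateRow _ continuous_const ?_)
        continuous_const
      fun_prop
    have htend : Tendsto (fun t : ℝ => (Y.updateRow b (Y b + t • Y a)).mulVec c) (𝓝[>] 0)
        (𝓝 (Y.mulVec c)) := by
      have := (hcont.tendsto 0).mono_left (nhdsWithin_le_nhds (s := Set.Ioi 0))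
      simpa using this
    obtain ⟨t, ht, hpos⟩ := ((hA.eventually htend).and self_mem_nhdsWithin).exists
    exact hnot t hpos ht

/-! ### Sign consistency implies variation bounding -/

/-- Multilinearity in the columns gives Cauchy–Binet before equal column sets are collected. This
form suffices because, for block matrices `M`, only increasing `f` contribute. -/
theorem Matrix.det_submatrix_mul_eq_sum {n m k : ℕ} (X : Matrix (Fin n) (Fin m) ℝ)
    (M : Matrix (Fin m) (Fin k) ℝ) (I : Fin k → Fin n) :
    ((X * M).submatrix I id).det =
      ∑ f : Fin k → Fin m, (∏ i, M (f i) i) * (X.submatrix I f).det := by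
  have h1 : ((X * M).submatrix I id).transpose =
      fun i => ∑ j, M j i • (fun r => X (I r) j : Fin k → ℝ) := by
    ext i r
    simp [Matrix.mul_apply, Finset.sum_apply, mul_comm]
  rw [← Matrix.det_transpose, h1]
  have h2 := (Matrix.detRowAlternating (n := Fin k) (R := ℝ)).toMultilinearMap.map_sum
    (fun i j => M j i • (fun r => X (I r) j : Fin k → ℝ))
  refine h2.trans (Finset.sum_congr rfl fun f _ => ?_)
  rw [MultilinearMap.map_smul_univ, smul_eq_mul, ← Matrix.det_transpose (X.submatrix I f)]
  rfl

/-- A grouping into at most `k` blocks can be refined to one into exactly `k` blocks. -/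
theorem IsGrouping.exists_surjective_refinement {m k : ℕ} {σ : ℝ} {u : Fin m → ℝ} {g₀ : Fin m → ℕ}
    (h : IsGrouping σ u g₀) (hk : 1 ≤ k) (hkm : k ≤ m) (hb : ∀ j, g₀ j < k) :
    ∃ g : Fin m → Fin k, Monotone g ∧ Function.Surjective g ∧ ∀ j j', g j = g j' → g₀ j = g₀ j' := by
  have hm0 := h.monotone
  -- With truncated subtraction, the second term is `0` at first and then climbs by one per position
  -- up to `k - 1` at the last. The maximum still rises by at most one per position, so it meets
  -- every block number. Where the second term dominates and is positive it is strictly increasing,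
  -- so distinct blocks of `g₀` are never joined.
  set G : Fin m → ℕ := fun j => max (g₀ j) (j.val + k - m) with hG
  have hGk : ∀ j, G j < k := fun j => by
    have := hb j
    simp only [hG]; omega
  have hGm : Monotone G := fun a b hab => by
    have := hm0 hab
    rw [Fin.le_def] at hab
    simp only [hG]; omega
  have hker : ∀ j j', j < j' → G j = G j' → g₀ j = g₀ j' := by
    intro j j' hlt he
    have := hm0 hlt.le
    rw [Fin.lt_def] at hlt
    simp only [hG] at he
    omega
  refine ⟨fun j => ⟨G j, hGk j⟩, fun a b hab => hGm hab, ?_, ?_⟩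
  · intro i
    have hne : ({j | i.val ≤ G j} : Set (Fin m)).Nonempty :=
      ⟨⟨m - 1, by omega⟩, by simp only [Set.mem_ofPred_eq, hG]; omega⟩
    obtain ⟨j, hj, hmin⟩ := WellFounded.has_min (wellFounded_lt (α := Fin m)) _ hne
    refine ⟨j, Fin.ext (le_antisymm ?_ hj)⟩
    simp only
    by_cases hj0 : j.val = 0
    · have := h.start j hj0
      simp only [hG]; omega
    · set j₁ : Fin m := ⟨j.val - 1, by omega⟩ with hj₁
      have hs := h.step j₁ j (by simp only [hj₁]; omega)
      have hlt : ¬ i.val ≤ G j₁ := fun hc => hmin j₁ hc (by rw [Fin.lt_def]; simp only [hj₁]; omega)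
      simp only [hG, hj₁] at hlt hs ⊢
      omega
  · intro j j' he
    have he' : G j = G j' := congrArg Fin.val he
    rcases lt_trichotomy j j' with hl | rfl | hl
    · exact hker _ _ hl he'
    · rfl
    · exact (hker _ _ hl he'.symm).symm

open Filter Topology in
/-- A matrix whose minors of order `k` have one sign, with `k` columns always independent, maps
vectors with fewer than `k` sign changes to vectors with fewer than `k` sign changes. -/
theorem variation_mulVec_lt_of_minors {n m k : ℕ} (hk : 1 ≤ k) (hkm : k ≤ m)
    (X : Matrix (Fin n) (Fin m) ℝ) (ε : ℝ)
    (hX : ∀ I J, StrictMono I → StrictMono J →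
      0 ≤ ε * (X.submatrix (I : Fin k → Fin n) (J : Fin k → Fin m)).det)
    (hne : ∀ J : Fin k → Fin m, StrictMono J →
      ∃ I : Fin k → Fin n, StrictMono I ∧ ε * (X.submatrix I J).det ≠ 0)
    (u : Fin m → ℝ) (hu : u ≠ 0) (huk : variation u < k) : variation (X.mulVec u) < k := by
  obtain ⟨σ, hσ, -, ⟨g₀, hg₀, hgb⟩, -⟩ := exists_grouping_and_alternation u hu
  have hb : ∀ j, g₀ j < k := fun j => by
    unfold variation at huk
    rw [if_neg hu] at huk
    have := hgb j
    omega
  obtain ⟨g, hg, hgs, hgk⟩ := hg₀.exists_surjective_refinement hk hkm hb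
  obtain ⟨s, hs⟩ := hgs.hasRightInverse
  set c : Fin k → ℝ := fun i => σ * (-1) ^ g₀ (s i) with hc
  have hcu : ∀ j, c (g j) * |u j| = u j := by
    intro j
    have h1 : g₀ (s (g j)) = g₀ j := hgk _ _ (hs (g j))
    have h2 := hg₀.sign j
    simp only [hc, h1]
    have h3 : σ * (-1) ^ g₀ j = 1 ∨ σ * (-1) ^ g₀ j = -1 := by
      rcases hσ with rfl | rfl <;> rcases neg_one_pow_eq_or ℝ (g₀ j) with h | h <;> simp [h]
    rcases h3 with h3 | h3 <;> rw [h3] at h2 ⊢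
    · rw [abs_of_nonneg (by linarith)]; ring
    · rw [abs_of_nonpos (by linarith)]; ring
  -- Column `i` carries `|u| + t` on block `i`, so `M 0` maps the block signs `c` to `u`. For `t >
  -- 0` all block entries are positive, hence every section of `g` contributes with positive weight,
  -- and one of them has a nonzero minor.
  set M : ℝ → Matrix (Fin m) (Fin k) ℝ := fun t =>
    Matrix.of fun j i => if g j = i then |u j| + t else 0 with hM
  have hMc : ∀ t, (M t).mulVec c = fun j => (|u j| + t) * c (g j) := by
    intro t
    funext j
    simp [M, Matrix.mulVec, dotProduct]
  have hnot : ∀ t : ℝ, 0 < t → ¬ HasAlternation k (X.mulVec ((M t).mulVec c)) := by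
    intro t ht
    have hw : ∀ j, 0 < |u j| + t := fun j => by positivity
    have hterm : ∀ (I : Fin k → Fin n), StrictMono I → ∀ f : Fin k → Fin m,
        0 ≤ (∏ i, M t (f i) i) * (ε * (X.submatrix I f).det) := by
      intro I hI f
      by_cases hf : ∀ i, g (f i) = i
      · have hfm : StrictMono f := fun a b hab => by
          by_contra hcon
          have := hg (not_lt.1 hcon)
          rw [hf, hf] at this
          exact absurd hab (not_lt.2 this)
        refine mul_nonneg (Finset.prod_nonneg fun i _ => ?_) (hX I f hI hfm)
        simp only [hM, Matrix.of_apply]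
        split_ifs
        · exact (hw _).le
        · exact le_rfl
      · push Not at hf
        obtain ⟨i, hi⟩ := hf
        rw [Finset.prod_eq_zero (Finset.mem_univ i) (by simp [hM, hi]), zero_mul]
    have hdet : ∀ I : Fin k → Fin n, ε * ((X * M t).submatrix I id).det =
        ∑ f : Fin k → Fin m, (∏ i, M t (f i) i) * (ε * (X.submatrix I f).det) := by
      intro I
      rw [Matrix.det_submatrix_mul_eq_sum, Finset.mul_sum]
      exact Finset.sum_congr rfl fun f _ => by ring
    have hsm : StrictMono s := fun a b hab => by
      by_contra hcon
      have := hg (not_lt.1 hcon)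
      rw [hs, hs] at this
      exact absurd hab (not_lt.2 this)
    obtain ⟨I, hI, hIs⟩ := hne s hsm
    rw [Matrix.mulVec_mulVec]
    refine not_hasAlternation_of_minors_nonneg ε (X * M t) (fun L hL => ?_) hI ?_ c
    · rw [hdet]
      exact Finset.sum_nonneg fun f _ => hterm L hL f
    · rw [hdet]
      refine (Finset.sum_pos' (fun f _ => hterm I hI f) ⟨s, Finset.mem_univ _, ?_⟩).ne'
      refine mul_pos (Finset.prod_pos fun i _ => ?_) (lt_of_le_of_ne (hX I s hI hsm) hIs.symm)
      have : g (s i) = i := hs i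
      simp only [hM, Matrix.of_apply, if_pos this]
      exact hw _
  rw [variation_lt_iff]
  intro hA
  have hcont : Continuous fun t : ℝ => X.mulVec ((M t).mulVec c) := by
    simp only [hMc]
    refine Continuous.matrix_mulVec continuous_const ?_
    fun_prop
  have htend : Tendsto (fun t : ℝ => X.mulVec ((M t).mulVec c)) (𝓝[>] 0) (𝓝 (X.mulVec u)) := by
    have := (hcont.tendsto 0).mono_left (nhdsWithin_le_nhds (s := Set.Ioi 0))
    have h0 : (M 0).mulVec c = u := by
      rw [hMc]
      funext j
      rw [add_zero, mul_comm, hcu]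
    rwa [h0] at this
  obtain ⟨t, ht, hpos⟩ := ((hA.eventually htend).and self_mem_nhdsWithin).exists
  exact hnot t hpos ht

/-! ### Absence of alternation forces one sign on the maximal minors -/

theorem Matrix.exists_minor_ne_zero {n k : ℕ} {Y : Matrix (Fin n) (Fin k) ℝ}
    (h : LinearIndependent ℝ Y.col) :
    ∃ L : Fin k → Fin n, StrictMono L ∧ (Y.submatrix L id).det ≠ 0 := by
  obtain ⟨κ, a, ha, hspan, hli⟩ := exists_linearIndependent' ℝ Y.row
  have : Finite κ := Finite.of_injective a ha
  have := Fintype.ofFinite κ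
  have hcard : Fintype.card κ = k := by
    rw [← finrank_span_eq_card hli, hspan, ← Matrix.rank_eq_finrank_span_row,
      Matrix.rank_eq_finrank_span_cols, finrank_span_eq_card h, Fintype.card_fin]
  have hS : (Finset.univ.image a).card = k := by
    rw [Finset.card_image_of_injective _ ha, Finset.card_univ, hcard]
  set L := (Finset.univ.image a).orderEmbOfFin hS with hL
  refine ⟨L, L.strictMono, ?_⟩
  have h1 : LinearIndepOn ℝ Y.row (Set.range L) := by
    rw [hL, Finset.range_orderEmbOfFin, Finset.coe_image, Finset.coe_univ, Set.image_univ]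
    exact (linearIndepOn_range_iff ha _).2 hli
  have h2 : LinearIndependent ℝ (Y.submatrix L id).row :=
    (linearIndepOn_range_iff L.injective _).1 h1
  rw [Matrix.linearIndependent_rows_iff_isUnit, Matrix.isUnit_iff_isUnit_det] at h2
  exact h2.ne_zero

/-- If no vector in the range of `Y` has `k` sign changes, two maximal minors whose rows lie in a
common set of `k + 1` rows do not have opposite signs. -/
theorem minor_mul_minor_nonneg_of_succAbove {n k : ℕ} {Y : Matrix (Fin n) (Fin k) ℝ}
    (hY : ∀ c, ¬ HasAlternation k (Y.mulVec c)) {R : Fin (k + 1) → Fin n} (hR : StrictMono R)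
    (p q : Fin (k + 1)) :
    0 ≤ (Y.submatrix (R ∘ p.succAbove) id).det * (Y.submatrix (R ∘ q.succAbove) id).det := by
  by_contra hcon
  rw [not_le] at hcon
  set Δ : Fin (k + 1) → ℝ := fun r => (Y.submatrix (R ∘ r.succAbove) id).det with hΔ
  change Δ p * Δ q < 0 at hcon
  -- As minors of both signs occur, `x` can be chosen so that `Δ x` does not have the sign of the
  -- total. Raising the weight at `x` alone then balances the sum with all weights `a r` positive.
  obtain ⟨x, hx, hxT⟩ : ∃ x, Δ x ≠ 0 ∧ 0 ≤ -(∑ r, Δ r) / Δ x := by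
    have hp : Δ p ≠ 0 := by intro h; simp [h] at hcon
    have hq : Δ q ≠ 0 := by intro h; simp [h] at hcon
    rcases mul_neg_iff.1 hcon with ⟨h1, h2⟩ | ⟨h1, h2⟩ <;>
      rcases le_total 0 (∑ r, Δ r) with h | h
    · exact ⟨q, hq, div_nonneg_of_nonpos (by linarith) h2.le⟩
    · exact ⟨p, hp, div_nonneg (by linarith) h1.le⟩
    · exact ⟨p, hp, div_nonneg_of_nonpos (by linarith) h1.le⟩
    · exact ⟨q, hq, div_nonneg (by linarith) h2.le⟩
  set a : Fin (k + 1) → ℝ := fun r => 1 + if r = x then -(∑ r, Δ r) / Δ x else 0 with ha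
  have ha0 : ∀ r, 0 < a r := fun r => by
    simp only [ha]; split_ifs <;> linarith
  have haΔ : ∑ r, a r * Δ r = 0 := by
    simp only [ha, add_mul, ite_mul, one_mul, zero_mul, Finset.sum_add_distrib,
      Finset.sum_ite_eq', Finset.mem_univ, if_true]
    field_simp
    ring
  set z : Fin (k + 1) → ℝ := fun r => (-1) ^ (r : ℕ) * a r with hz
  set N := Y.submatrix (R ∘ x.succAbove) id with hN
  have hNu : IsUnit N.det := isUnit_iff_ne_zero.2 hx
  set c := N⁻¹.mulVec (z ∘ x.succAbove) with hc
  have hNc : N.mulVec c = z ∘ x.succAbove := by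
    rw [hc, Matrix.mulVec_mulVec, Matrix.mul_nonsing_inv _ hNu, Matrix.one_mulVec]
  have hrow : ∀ i, (Y.mulVec c) (R (x.succAbove i)) = z (x.succAbove i) := fun i => congrFun hNc i
  have hsum := sum_alternating_mul_minor_eq_zero Y R c
  -- `c` is solved from the rows other than `x`. Both `Y c` and the alternating target `z` satisfy
  -- the linear relation, so they also agree at `x`.
  have hdiff : ∑ r : Fin (k + 1), (-1) ^ (r : ℕ) * ((Y.mulVec c) (R r) - z r) * Δ r = 0 := by
    have : ∑ r : Fin (k + 1), (-1) ^ (r : ℕ) * z r * Δ r = 0 := by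
      rw [← haΔ]
      refine Finset.sum_congr rfl fun r _ => ?_
      simp only [hz]
      rw [← mul_assoc ((-1 : ℝ) ^ (r : ℕ)), ← pow_add, ← two_mul, pow_mul]
      simp
    rw [← sub_eq_zero.2 (hsum.trans this.symm), ← Finset.sum_sub_distrib]
    exact Finset.sum_congr rfl fun r _ => by simp only [hΔ]; ring
  rw [Fin.sum_univ_succAbove _ x, Finset.sum_eq_zero (fun i _ => by rw [hrow]; ring), add_zero]
    at hdiff
  have hxz : (Y.mulVec c) (R x) = z x := by
    have := (mul_eq_zero.1 hdiff).resolve_right hx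
    have := (mul_eq_zero.1 this).resolve_left (pow_ne_zero _ (by norm_num))
    linarith
  refine hY c ⟨1, R, hR, fun r => ?_⟩
  have hr : (Y.mulVec c) (R r) = z r := by
    rcases eq_or_ne r x with rfl | h
    · exact hxz
    · obtain ⟨i, rfl⟩ := Fin.exists_succAbove_eq h
      exact hrow i
  rw [hr, hz, one_mul]
  simp only
  rw [← mul_assoc, ← pow_add, ← two_mul, pow_mul]
  simpa using ha0 r

/-! ### Exchange of single elements between increasing tuples -/

section Exchange

variable {α : Type*} [LinearOrder α] {k : ℕ}

theorem StrictMono.ncard_range {L : Fin k → α} (hL : StrictMono L) : (Set.range L).ncard = k := by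
  rw [← Set.image_univ, Set.ncard_image_of_injective _ hL.injective, Set.ncard_univ,
    Nat.card_eq_fintype_card, Fintype.card_fin]

theorem range_comp_succAbove {R : Fin (k + 1) → α} (hR : StrictMono R) (r : Fin (k + 1)) :
    Set.range (R ∘ r.succAbove) = Set.range R \ {R r} := by
  rw [Set.range_comp, Fin.range_succAbove, ← Set.image_singleton,
    Set.image_compl_eq_range_sdiff_image hR.injective]

/-- An increasing tuple and a new element lie in a common increasing tuple that is longer by
one. -/
theorem exists_strictMono_succAbove {L : Fin k → α} (hL : StrictMono L) {b : α}
    (hb : b ∉ Set.range L) (q : Fin k) :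
    ∃ (R : Fin (k + 1) → α) (r r' : Fin (k + 1)), StrictMono R ∧ R ∘ r.succAbove = L ∧ R r = b ∧
      R r' = L q ∧ Set.range R = insert b (Set.range L) := by
  have hb' : b ∉ Finset.univ.image L := by simpa using hb
  have hS : (insert b (Finset.univ.image L)).card = k + 1 := by
    rw [Finset.card_insert_of_notMem hb', Finset.card_image_of_injective _ hL.injective,
      Finset.card_univ, Fintype.card_fin]
  set R := (insert b (Finset.univ.image L)).orderEmbOfFin hS with hR
  have hr : Set.range R = insert b (Set.range L) := by
    rw [hR, Finset.range_orderEmbOfFin]; simp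
  obtain ⟨r, hrb⟩ : b ∈ Set.range R := by rw [hr]; exact Set.mem_insert _ _
  obtain ⟨r', hrq⟩ : L q ∈ Set.range R := by
    rw [hr]; exact Set.mem_insert_of_mem _ (Set.mem_range_self q)
  refine ⟨R, r, r', R.strictMono, ?_, hrb, hrq, hr⟩
  refine ((R.strictMono.comp (Fin.strictMono_succAbove r)).range_inj hL).1 ?_
  rw [range_comp_succAbove R.strictMono, hr, hrb, Set.insert_sdiff_self_of_notMem hb]

/-- A relation on increasing tuples that is transitive and holds for suitable exchanges of one
element holds for all admissible tuples. -/
theorem rel_of_exchange {B : (Fin k → α) → Prop} {rel : (Fin k → α) → (Fin k → α) → Prop}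
    (hrefl : ∀ L, B L → rel L L)
    (htrans : ∀ L₁ L₂ L₃, B L₂ → rel L₁ L₂ → rel L₂ L₃ → rel L₁ L₃)
    (hex : ∀ (L L' : Fin k → α) (q : Fin k), StrictMono L → StrictMono L' → B L → B L' →
      L q ∉ Set.range L' → ∃ b ∈ Set.range L', b ∉ Set.range L ∧
        ∀ (R : Fin (k + 1) → α) (r r' : Fin (k + 1)), StrictMono R → R ∘ r.succAbove = L →
          R r = b → R r' = L q → B (R ∘ r'.succAbove) ∧ rel L (R ∘ r'.succAbove))
    {L L' : Fin k → α} (hL : StrictMono L) (hL' : StrictMono L') (hB : B L) (hB' : B L') :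
    rel L L' := by
  induction hN : (Set.range L \ Set.range L').ncard using Nat.strong_induction_on
    generalizing L with
  | _ N ih =>
    by_cases hsub : Set.range L ⊆ Set.range L'
    · have heq := Set.eq_of_subset_of_ncard_le hsub (by rw [hL.ncard_range, hL'.ncard_range])
      rw [(hL.range_inj hL').1 heq]
      exact hrefl _ hB'
    · obtain ⟨_, ⟨q, rfl⟩, hq⟩ := Set.not_subset.1 hsub
      obtain ⟨b, hbL', hbL, hb⟩ := hex L L' q hL hL' hB hB' hq
      obtain ⟨R, r, r', hR, hRL, hRb, hRq, hrange⟩ := exists_strictMono_succAbove hL hbL q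
      obtain ⟨hB'', hrel⟩ := hb R r r' hR hRL hRb hRq
      refine htrans _ _ _ hB'' hrel (ih _ ?_ (hR.comp (Fin.strictMono_succAbove r')) hB'' rfl)
      rw [← hN]
      refine Set.ncard_lt_ncard ⟨?_, fun h => ?_⟩ ((Set.finite_range L).sdiff)
      · rw [range_comp_succAbove hR, hrange, hRq]
        rintro y ⟨⟨hy | hy, -⟩, hy'⟩
        · exact absurd (hy ▸ hbL') hy'
        · exact ⟨hy, hy'⟩
      · have := (h ⟨Set.mem_range_self q, hq⟩).1
        rw [range_comp_succAbove hR, hRq] at this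
        exact this.2 rfl

end Exchange

theorem Matrix.linearIndepOn_row_range_iff {n k : ℕ} (Y : Matrix (Fin n) (Fin k) ℝ)
    {L : Fin k → Fin n} (hL : StrictMono L) :
    LinearIndepOn ℝ Y.row (Set.range L) ↔ (Y.submatrix L id).det ≠ 0 := by
  rw [linearIndepOn_range_iff hL.injective, ← isUnit_iff_ne_zero, ← Matrix.isUnit_iff_isUnit_det,
    ← Matrix.linearIndependent_rows_iff_isUnit]
  rfl

/-- If no vector in the range of `Y` has `k` sign changes, the maximal minors of `Y` have one
sign. -/
theorem minor_mul_minor_nonneg {n k : ℕ} {Y : Matrix (Fin n) (Fin k) ℝ}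
    (hY : ∀ c, ¬ HasAlternation k (Y.mulVec c)) {L L' : Fin k → Fin n} (hL : StrictMono L)
    (hL' : StrictMono L') :
    0 ≤ (Y.submatrix L id).det * (Y.submatrix L' id).det := by
  by_cases hB : (Y.submatrix L id).det = 0
  · simp [hB]
  by_cases hB' : (Y.submatrix L' id).det = 0
  · simp [hB']
  refine rel_of_exchange (B := fun L => (Y.submatrix L id).det ≠ 0)
    (rel := fun L L' => 0 ≤ (Y.submatrix L id).det * (Y.submatrix L' id).det)
    (fun L _ => mul_self_nonneg _) ?_ ?_ hL hL' hB hB'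
  · intro L₁ L₂ L₃ h2 h12 h23
    have h := mul_nonneg h12 h23
    have h2' : 0 < (Y.submatrix L₂ id).det ^ 2 := by positivity
    refine nonneg_of_mul_nonneg_left ?_ h2'
    linarith
  · intro L L' q hL hL' hB hB' hq
    have hliL := (Y.linearIndepOn_row_range_iff hL).2 hB
    have hliL' := (Y.linearIndepOn_row_range_iff hL').2 hB'
    -- Steinitz exchange: the `k` independent rows of `L'` cannot all lie in the span of the `k - 1`
    -- rows of `L` other than `L q`.
    obtain ⟨b, hb, hbs⟩ : ∃ b ∈ Set.range L',
        Y.row b ∉ Submodule.span ℝ (Y.row '' (Set.range L \ {L q})) := by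
      by_contra hcon
      push Not at hcon
      have hle : Submodule.span ℝ (Y.row '' Set.range L') ≤
          Submodule.span ℝ (Y.row '' (Set.range L \ {L q})) := by
        rw [Submodule.span_le]
        rintro _ ⟨b, hb, rfl⟩
        exact hcon b hb
      have hcard : ∀ {s : Set (Fin n)}, LinearIndepOn ℝ Y.row s →
          Module.finrank ℝ (Submodule.span ℝ (Y.row '' s)) = s.ncard := by
        intro s hs
        have := Fintype.ofFinite s
        have h := finrank_span_eq_card (R := ℝ) hs
        rw [← Nat.card_eq_fintype_card, Nat.card_coe_set_eq] at h
        rw [← h, Set.image_eq_range]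
      have h1 := Submodule.finrank_mono hle
      rw [hcard hliL', hcard (hliL.mono Set.sdiff_subset)] at h1
      have h2 := Set.ncard_sdiff_singleton_lt_of_mem (Set.mem_range_self (f := L) q)
      rw [hL.ncard_range] at h2
      rw [hL'.ncard_range] at h1
      omega
    have hbL : b ∉ Set.range L := by
      rintro ⟨i, rfl⟩
      rcases eq_or_ne i q with rfl | hi
      · exact hq hb
      · exact hbs (Submodule.subset_span ⟨L i, ⟨Set.mem_range_self i, hL.injective.ne hi⟩, rfl⟩)
    refine ⟨b, hb, hbL, fun R r r' hR hRL hRb hRq => ⟨?_, ?_⟩⟩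
    · rw [← Y.linearIndepOn_row_range_iff (hR.comp (Fin.strictMono_succAbove r'))]
      refine ((hliL.mono Set.sdiff_subset).insert hbs).mono ?_
      have h := range_comp_succAbove hR r
      rw [hRL, hRb] at h
      rw [range_comp_succAbove hR, hRq, h]
      rintro y ⟨hy, hyq⟩
      by_cases hyb : y = b
      · exact Or.inl hyb
      · exact Or.inr ⟨⟨hy, hyb⟩, hyq⟩
    · have := minor_mul_minor_nonneg_of_succAbove hY hR r r'
      rwa [hRL] at this

/-! ### Merging two neighbouring columns -/

/-- Two families whose nonnegative combinations each have one sign and do not vanish have the same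
sign. -/
theorem mul_nonneg_of_combinations {ι : Type*} {a b : ι → ℝ}
    (h : ∀ s t : ℝ, 0 ≤ s → 0 ≤ t → ∀ i j, 0 ≤ (s * a i + t * b i) * (s * a j + t * b j))
    (hne : ∀ s t : ℝ, (s ≠ 0 ∨ t ≠ 0) → ∃ i, s * a i + t * b i ≠ 0) (i j : ι) :
    0 ≤ a i * b j := by
  have main : ∀ a b : ι → ℝ,
      (∀ s t : ℝ, 0 ≤ s → 0 ≤ t → ∀ i j, 0 ≤ (s * a i + t * b i) * (s * a j + t * b j)) →
      (∀ s t : ℝ, (s ≠ 0 ∨ t ≠ 0) → ∃ i, s * a i + t * b i ≠ 0) → ∀ x y, 0 < a x → ¬ b y < 0 := by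
    intro a b h hne x y hx hy
    have ha : ∀ i, 0 ≤ a i := fun i => by
      have := h 1 0 zero_le_one le_rfl x i
      simp only [one_mul, zero_mul, add_zero] at this
      exact nonneg_of_mul_nonneg_right this hx
    have hb : ∀ i, b i ≤ 0 := fun i => by
      have := h 0 1 le_rfl zero_le_one y i
      simp only [one_mul, zero_mul, zero_add] at this
      by_contra hc
      nlinarith
    obtain ⟨i, hi⟩ := hne (-b x) (a x) (Or.inr hx.ne')
    apply hi
    -- These weights give opposite values at `x` and `i`, so the value at `i`, which is the
    -- combination with weights `-b x` and `a x`, is zero.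
    have := h (-(b x + b i)) (a x + a i) (by linarith [hb x, hb i]) (by linarith [ha i]) x i
    have hsq : (-b x * a i + a x * b i) ^ 2 ≤ 0 := by linarith
    exact pow_eq_zero_iff two_ne_zero |>.1 (le_antisymm hsq (sq_nonneg _))
  by_contra hcon
  rcases mul_neg_iff.1 (not_le.1 hcon) with ⟨h1, h2⟩ | ⟨h1, h2⟩
  · exact main a b h hne i j h1 h2
  · refine main (fun i => -a i) (fun i => -b i) (fun s t hs ht i j => ?_) (fun s t hst => ?_) i j
      (neg_pos.2 h1) (neg_neg_of_pos h2)
    · have := h s t hs ht i j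
      linarith
    · obtain ⟨x, hx⟩ := hne s t hst
      refine ⟨x, fun h => hx ?_⟩
      linarith

theorem StrictMono.eq_of_forall_mem_range {α : Type*} [LinearOrder α] {k : ℕ} {C i : Fin k → α}
    (hC : StrictMono C) (hi : StrictMono i) (h : ∀ r, i r ∈ Set.range C) : i = C := by
  refine (hi.range_inj hC).1 (Set.eq_of_subset_of_ncard_le ?_ ?_ (Set.finite_range C))
  · rintro _ ⟨r, rfl⟩
    exact h r
  · rw [hC.ncard_range, hi.ncard_range]

/-- The columns of `Z` other than the `p`-th and the next one, which are replaced by a single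
combination of the two. -/
noncomputable def mergeCols {n k : ℕ} (Z : Matrix (Fin n) (Fin (k + 1)) ℝ) (p : Fin k) (s t : ℝ) :
    Matrix (Fin n) (Fin k) ℝ :=
  (Z.submatrix id p.succ.succAbove).updateCol p (s • Z.col p.castSucc + t • Z.col p.succ)

/-- The coefficients with respect to the columns of `Z` of a combination of the merged columns. -/
noncomputable def splitCoeff {k : ℕ} (p : Fin k) (s t : ℝ) (c : Fin k → ℝ) : Fin (k + 1) → ℝ :=
  p.succ.insertNth (α := fun _ => ℝ) (t * c p) (Function.update c p (s * c p))

theorem splitCoeff_succ {k : ℕ} (p : Fin k) (s t : ℝ) (c : Fin k → ℝ) :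
    splitCoeff p s t c p.succ = t * c p := by
  simp [splitCoeff]

theorem splitCoeff_succAbove {k : ℕ} (p : Fin k) (s t : ℝ) (c : Fin k → ℝ) (l : Fin k) :
    splitCoeff p s t c (p.succ.succAbove l) = Function.update c p (s * c p) l := by
  simp [splitCoeff]

theorem splitCoeff_castSucc {k : ℕ} (p : Fin k) (s t : ℝ) (c : Fin k → ℝ) :
    splitCoeff p s t c p.castSucc = s * c p := by
  have := splitCoeff_succAbove p s t c p
  rwa [Fin.succAbove_succ_self, Function.update_self] at this

theorem mergeCols_mulVec {n k : ℕ} (Z : Matrix (Fin n) (Fin (k + 1)) ℝ) (p : Fin k) (s t : ℝ)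
    (c : Fin k → ℝ) : (mergeCols Z p s t).mulVec c = Z.mulVec (splitCoeff p s t c) := by
  funext i
  simp only [Matrix.mulVec, dotProduct]
  rw [Fin.sum_univ_succAbove _ p.succ, splitCoeff_succ]
  simp only [splitCoeff_succAbove]
  rw [← Finset.add_sum_erase _ _ (Finset.mem_univ p),
    ← Finset.add_sum_erase Finset.univ (fun l => Z i (p.succ.succAbove l) * _) (Finset.mem_univ p),
    ← add_assoc]
  congr 1
  · simp [mergeCols]
    ring
  · refine Finset.sum_congr rfl fun l hl => ?_
    have hl' := Finset.ne_of_mem_erase hl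
    simp [mergeCols, hl']

theorem Fin.succ_succAbove_eq_castSucc_succAbove {k : ℕ} {p l : Fin k} (h : l ≠ p) :
    p.succ.succAbove l = p.castSucc.succAbove l := by
  rcases lt_or_gt_of_ne h with h | h
  · rw [Fin.succAbove_of_castSucc_lt _ _ (by rw [Fin.lt_def] at *; simp; omega),
      Fin.succAbove_of_castSucc_lt _ _ (by rw [Fin.lt_def] at *; simp; omega)]
  · rw [Fin.succAbove_of_le_castSucc _ _ (by rw [Fin.le_def]; rw [Fin.lt_def] at h; simp; omega),
      Fin.succAbove_of_le_castSucc _ _ (by rw [Fin.le_def]; rw [Fin.lt_def] at h; simp; omega)]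

/-- Linearity in the merged column. Since the two columns are neighbours, either one fits in place
`p` without a change of sign. -/
theorem det_submatrix_mergeCols {n k : ℕ} (Z : Matrix (Fin n) (Fin (k + 1)) ℝ) (p : Fin k)
    (s t : ℝ) (I : Fin k → Fin n) :
    ((mergeCols Z p s t).submatrix I id).det =
      s * (Z.submatrix I p.succ.succAbove).det + t * (Z.submatrix I p.castSucc.succAbove).det := by
  have h1 : (mergeCols Z p s t).submatrix I id = (Z.submatrix I p.succ.succAbove).updateCol p
      (s • (fun i => Z (I i) p.castSucc) + t • (fun i => Z (I i) p.succ)) := by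
    ext i l
    by_cases hl : l = p
    · subst hl; simp [mergeCols]
    · simp [mergeCols, hl]
  have h2 : (Z.submatrix I p.succ.succAbove).updateCol p (fun i => Z (I i) p.castSucc) =
      Z.submatrix I p.succ.succAbove := by
    ext i l
    by_cases hl : l = p
    · subst hl; simp
    · simp [hl]
  have h3 : (Z.submatrix I p.succ.succAbove).updateCol p (fun i => Z (I i) p.succ) =
      Z.submatrix I p.castSucc.succAbove := by
    ext i l
    by_cases hl : l = p
    · subst hl; simp
    · simp [hl, Fin.succ_succAbove_eq_castSucc_succAbove hl]
  rw [h1, Matrix.det_updateCol_add, Matrix.det_updateCol_smul, Matrix.det_updateCol_smul, h2, h3]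

theorem linearIndependent_col_mergeCols {n k : ℕ} {Z : Matrix (Fin n) (Fin (k + 1)) ℝ}
    (hZ : LinearIndependent ℝ Z.col) (p : Fin k) {s t : ℝ} (hst : s ≠ 0 ∨ t ≠ 0) :
    LinearIndependent ℝ (mergeCols Z p s t).col := by
  rw [← Matrix.mulVec_injective_iff] at hZ ⊢
  have key : ∀ c, (mergeCols Z p s t).mulVec c = 0 → c = 0 := by
    intro c hc
    rw [mergeCols_mulVec, ← Matrix.mulVec_zero Z] at hc
    have hd := hZ hc
    funext l
    by_cases hl : l = p
    · subst hl
      have h1 := congrFun hd l.castSucc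
      have h2 := congrFun hd l.succ
      rw [splitCoeff_castSucc] at h1
      rw [splitCoeff_succ] at h2
      rcases hst with h | h
      · exact (mul_eq_zero.1 h1).resolve_left h
      · exact (mul_eq_zero.1 h2).resolve_left h
    · have h1 := congrFun hd (p.succ.succAbove l)
      rwa [splitCoeff_succAbove, Function.update_of_ne hl] at h1
  intro c c' h
  rw [← sub_eq_zero]
  exact key _ (by rw [Matrix.mulVec_sub]; exact sub_eq_zero.2 h)

/-! ### Comparing minors across column sets -/

section Columns

variable {n m k : ℕ} {X : Matrix (Fin n) (Fin m) ℝ}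

/-- A vector supported on the `k + 1` positions of `C` has `k` sign changes only if all its entries
alternate, which the pair at `p` prevents. -/
theorem not_hasAlternation_submatrix_mulVec
    (hX : ∀ u, ¬ HasAlternation k u → ¬ HasAlternation k (X.mulVec u))
    {C : Fin (k + 1) → Fin m} (hC : StrictMono C) {d : Fin (k + 1) → ℝ} {p : Fin k}
    (hd : 0 ≤ d p.castSucc * d p.succ) :
    ¬ HasAlternation k ((X.submatrix id C).mulVec d) := by
  set u : Fin m → ℝ := fun j => ∑ i, if C i = j then d i else 0 with hu
  have hXu : X.mulVec u = (X.submatrix id C).mulVec d := by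
    funext r
    simp only [Matrix.mulVec, dotProduct, hu, Finset.mul_sum, mul_ite, mul_zero]
    rw [Finset.sum_comm]
    simp
  rw [← hXu]
  apply hX
  rintro ⟨σ, i, hi, ha⟩
  have huC : ∀ r, u (C r) = d r := fun r => by
    simp [u, hC.injective.eq_iff]
  have hiC : i = C := hC.eq_of_forall_mem_range hi fun r => by
    by_contra hr
    have : u (i r) = 0 := Finset.sum_eq_zero fun l _ => if_neg fun h => hr ⟨l, h⟩
    have hr := ha r
    simp [this] at hr
  subst hiC
  have h1 := ha p.castSucc
  have h2 := ha p.succ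
  rw [huC] at h1 h2
  have h3 := mul_pos h1 h2
  simp only [Fin.val_succ, Fin.val_castSucc, pow_succ] at h3
  have h4 : 0 ≤ (σ * (-1) ^ (p : ℕ)) ^ 2 := sq_nonneg _
  have := mul_nonneg h4 hd
  linarith

/-- The minors in two column sets have no opposite signs. -/
def MinorsAgree (X : Matrix (Fin n) (Fin m) ℝ) (J J' : Fin k → Fin m) : Prop :=
  ∀ I I' : Fin k → Fin n, StrictMono I → StrictMono I' →
    0 ≤ (X.submatrix I J).det * (X.submatrix I' J').det

theorem MinorsAgree.symm {J J' : Fin k → Fin m} (h : MinorsAgree X J J') : MinorsAgree X J' J :=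
  fun I I' hI hI' => by rw [mul_comm]; exact h I' I hI' hI

/-- Independence of the middle columns supplies a nonzero minor to compare both sides with. -/
theorem MinorsAgree.trans {J₁ J₂ J₃ : Fin k → Fin m} (h₂ : LinearIndependent ℝ (X.col ∘ J₂))
    (h₁₂ : MinorsAgree X J₁ J₂) (h₂₃ : MinorsAgree X J₂ J₃) : MinorsAgree X J₁ J₃ := by
  intro I I' hI hI'
  obtain ⟨L, hL, hne⟩ := Matrix.exists_minor_ne_zero (Y := X.submatrix id J₂) h₂
  rw [Matrix.submatrix_submatrix] at hne
  change (X.submatrix L J₂).det ≠ 0 at hne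
  have h := mul_nonneg (h₁₂ I L hI hL) (h₂₃ L I' hL hI')
  have h2 : 0 < (X.submatrix L J₂).det ^ 2 := by positivity
  refine nonneg_of_mul_nonneg_left ?_ h2
  linarith

/-- For all weights `s, t ≥ 0` the merged matrix falls under the case of `k` columns, so the
combinations of the two families of minors have one sign. Independence keeps them from vanishing,
and `mul_nonneg_of_combinations` applies. -/
theorem minorsAgree_castSucc_succ
    (hX : ∀ u, ¬ HasAlternation k u → ¬ HasAlternation k (X.mulVec u))
    {C : Fin (k + 1) → Fin m} (hC : StrictMono C) (hli : LinearIndependent ℝ (X.col ∘ C))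
    (p : Fin k) :
    MinorsAgree X (C ∘ p.succ.succAbove) (C ∘ p.castSucc.succAbove) := by
  set Z := X.submatrix id C with hZ
  have hZli : LinearIndependent ℝ Z.col := hli
  have hmerge : ∀ s t : ℝ, 0 ≤ s → 0 ≤ t → ∀ c,
      ¬ HasAlternation k ((mergeCols Z p s t).mulVec c) := by
    intro s t hs ht c
    rw [mergeCols_mulVec]
    refine not_hasAlternation_submatrix_mulVec hX hC (p := p) ?_
    rw [splitCoeff_castSucc, splitCoeff_succ]
    have := mul_nonneg (mul_nonneg hs ht) (mul_self_nonneg (c p))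
    linarith
  intro I I' hI hI'
  refine mul_nonneg_of_combinations (ι := {I : Fin k → Fin n // StrictMono I})
    (a := fun I => (X.submatrix I.1 (C ∘ p.succ.succAbove)).det)
    (b := fun I => (X.submatrix I.1 (C ∘ p.castSucc.succAbove)).det) ?_ ?_ ⟨I, hI⟩ ⟨I', hI'⟩
  · rintro s t hs ht ⟨K, hK⟩ ⟨K', hK'⟩
    have := minor_mul_minor_nonneg (hmerge s t hs ht) hK hK'
    rwa [det_submatrix_mergeCols, det_submatrix_mergeCols] at this
  · intro s t hst
    obtain ⟨L, hL, hne⟩ := Matrix.exists_minor_ne_zero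
      (linearIndependent_col_mergeCols hZli p hst)
    rw [det_submatrix_mergeCols] at hne
    exact ⟨⟨L, hL⟩, hne⟩

/-- A vector supported on at most `k` positions cannot have `k + 1` alternating entries. -/
theorem minorsAgree_self
    (hX : ∀ u, ¬ HasAlternation k u → ¬ HasAlternation k (X.mulVec u))
    (J : Fin k → Fin m) : MinorsAgree X J J := by
  intro I I' hI hI'
  refine minor_mul_minor_nonneg (Y := X.submatrix id J) (fun c => ?_) hI hI'
  set u : Fin m → ℝ := fun j => ∑ i, if J i = j then c i else 0 with hu
  have hXu : X.mulVec u = (X.submatrix id J).mulVec c := by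
    funext r
    simp only [Matrix.mulVec, dotProduct, hu, Finset.mul_sum, mul_ite, mul_zero]
    rw [Finset.sum_comm]
    simp
  rw [← hXu]
  apply hX
  rintro ⟨σ, i, hi, ha⟩
  have hmem : ∀ r, i r ∈ Set.range J := fun r => by
    by_contra hr
    have : u (i r) = 0 := Finset.sum_eq_zero fun l _ => if_neg fun h => hr ⟨l, h⟩
    have hr := ha r
    simp [this] at hr
  choose f hf using hmem
  have hinj : Function.Injective f := fun a b hab => hi.injective (by rw [← hf, ← hf, hab])
  have := Fintype.card_le_of_injective f hinj
  simp at this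

theorem minorsAgree_succAbove
    (hX : ∀ u, ¬ HasAlternation k u → ¬ HasAlternation k (X.mulVec u))
    {C : Fin (k + 1) → Fin m} (hC : StrictMono C) (hli : LinearIndependent ℝ (X.col ∘ C))
    (r r' : Fin (k + 1)) : MinorsAgree X (C ∘ r.succAbove) (C ∘ r'.succAbove) := by
  have hsub : ∀ r : Fin (k + 1), LinearIndependent ℝ (X.col ∘ (C ∘ r.succAbove)) := fun r =>
    hli.comp r.succAbove Fin.succAbove_right_injective
  have h0 : ∀ r : Fin (k + 1),
      MinorsAgree X (C ∘ r.succAbove) (C ∘ (0 : Fin (k + 1)).succAbove) := by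
    intro r
    induction r using Fin.induction with
    | zero => exact minorsAgree_self hX _
    | succ p ih => exact (minorsAgree_castSucc_succ hX hC hli p).trans (hsub _) ih
  exact (h0 r).trans (hsub 0) (h0 r').symm

/-- The minors of order `k` of a matrix that maps vectors with fewer than `k` sign changes to such
vectors have one sign. -/
theorem minorsAgree_of_bounding
    (hX : ∀ u, ¬ HasAlternation k u → ¬ HasAlternation k (X.mulVec u))
    (hrank : k < X.rank)
    (hli : ∀ J : Fin k → Fin m, StrictMono J → LinearIndependent ℝ (X.col ∘ J))
    {J J' : Fin k → Fin m} (hJ : StrictMono J) (hJ' : StrictMono J') : MinorsAgree X J J' := by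
  refine rel_of_exchange (B := StrictMono) (rel := MinorsAgree X)
    (fun L _ => minorsAgree_self hX L) (fun _ _ _ h2 => MinorsAgree.trans (hli _ h2)) ?_
    hJ hJ' hJ hJ'
  intro L L' q hL hL' _ _ hq
  obtain ⟨b, hb, hbL⟩ : ∃ b ∈ Set.range L', b ∉ Set.range L := by
    by_contra hcon
    push Not at hcon
    have := Set.eq_of_subset_of_ncard_le (fun b hb => hcon b hb : Set.range L' ⊆ Set.range L)
      (by rw [hL.ncard_range, hL'.ncard_range])
    exact hq (this ▸ Set.mem_range_self q)
  refine ⟨b, hb, hbL, fun R r r' hR hRL hRb hRq => ?_⟩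
  have hL'' := hR.comp (Fin.strictMono_succAbove r')
  refine ⟨hL'', ?_⟩
  by_cases hRli : LinearIndependent ℝ (X.col ∘ R)
  · have := minorsAgree_succAbove hX hR hRli r r'
    rwa [hRL] at this
  -- If `L` together with `b` is dependent, the rank supplies a column `x` outside the span of `L`.
  -- The detour replaces `L q` by `x` and then `x` by `b`; adjoining `x` to either end yields `k +
  -- 1` independent columns.
  have hspan : ∀ {L : Fin k → Fin m} {x : Fin m}, StrictMono L →
      X.col x ∉ Submodule.span ℝ (X.col '' Set.range L) →
      ∀ R : Fin (k + 1) → Fin m, StrictMono R → Set.range R = insert x (Set.range L) →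
        LinearIndependent ℝ (X.col ∘ R) := by
    intro L x hL hx R hR hrange
    rw [← linearIndepOn_range_iff hR.injective, hrange]
    exact ((linearIndepOn_range_iff hL.injective _).2 (hli L hL)).insert hx
  have hdiff : Set.range L = Set.range R \ {b} := by
    rw [← hRL, range_comp_succAbove hR, hRb]
  have hdiff'' : Set.range (R ∘ r'.succAbove) = Set.range R \ {L q} := by
    rw [range_comp_succAbove hR, hRq]
  have hbR : b ∈ Set.range R := ⟨r, hRb⟩
  have hRins : Set.range R = insert b (Set.range L) := by
    rw [hdiff, Set.insert_sdiff_singleton, Set.insert_eq_of_mem hbR]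
  have hbspan : X.col b ∈ Submodule.span ℝ (X.col '' Set.range L) := by
    by_contra hcon
    exact hRli (hspan hL hcon R hR hRins)
  obtain ⟨x, hx⟩ : ∃ x, X.col x ∉ Submodule.span ℝ (X.col '' Set.range L) := by
    by_contra hcon
    push Not at hcon
    have hle : Submodule.span ℝ (Set.range X.col) ≤
        Submodule.span ℝ (Set.range (X.col ∘ L)) := by
      rw [Submodule.span_le, Set.range_comp]
      rintro _ ⟨x, rfl⟩
      exact hcon x
    have h1 := Submodule.finrank_mono hle
    rw [← Matrix.rank_eq_finrank_span_cols, finrank_span_eq_card (hli L hL), Fintype.card_fin] at h1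
    omega
  have hx'' : X.col x ∉ Submodule.span ℝ (X.col '' Set.range (R ∘ r'.succAbove)) := by
    intro hcon
    refine hx (Submodule.span_le.2 ?_ hcon)
    rintro _ ⟨y, hy, rfl⟩
    rw [hdiff'', hRins] at hy
    rcases hy.1 with rfl | hy
    · exact hbspan
    · exact Submodule.subset_span ⟨y, hy, rfl⟩
  have hxL : x ∉ Set.range L := fun h => hx (Submodule.subset_span ⟨x, h, rfl⟩)
  have hxL'' : x ∉ Set.range (R ∘ r'.succAbove) := fun h =>
    hx'' (Submodule.subset_span ⟨x, h, rfl⟩)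
  have hLqb : b ≠ L q := fun h => hbL (h ▸ Set.mem_range_self q)
  obtain ⟨q₂, hq₂⟩ : b ∈ Set.range (R ∘ r'.succAbove) := by
    rw [hdiff'']
    exact ⟨hbR, hLqb⟩
  obtain ⟨R₁, r₁, r₁', hR₁, hR₁L, -, hR₁q, hrange₁⟩ := exists_strictMono_succAbove hL hxL q
  obtain ⟨R₂, r₂, r₂', hR₂, hR₂L, -, hR₂q, hrange₂⟩ := exists_strictMono_succAbove hL'' hxL'' q₂
  have h1 := minorsAgree_succAbove hX hR₁ (hspan hL hx R₁ hR₁ hrange₁) r₁ r₁'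
  have h2 := minorsAgree_succAbove hX hR₂ (hspan hL'' hx'' R₂ hR₂ hrange₂) r₂ r₂'
  have hsm := hR₁.comp (Fin.strictMono_succAbove r₁')
  have heq : R₁ ∘ r₁'.succAbove = R₂ ∘ r₂'.succAbove := by
    refine (hsm.range_inj (hR₂.comp (Fin.strictMono_succAbove r₂'))).1 ?_
    rw [range_comp_succAbove hR₁, range_comp_succAbove hR₂, hR₁q, hR₂q, hq₂, hrange₁, hrange₂,
      hdiff'', hdiff]
    ext y
    have hbx : x ≠ b := fun h => hx (h ▸ hbspan)
    have hqx : x ≠ L q := fun h => hxL (h ▸ Set.mem_range_self q)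
    simp only [Set.mem_sdiff, Set.mem_insert_iff, Set.mem_singleton_iff]
    constructor
    · rintro ⟨rfl | ⟨h, h'⟩, h''⟩
      · exact ⟨Or.inl rfl, hbx⟩
      · exact ⟨Or.inr ⟨h, h''⟩, h'⟩
    · rintro ⟨rfl | ⟨h, h'⟩, h''⟩
      · exact ⟨Or.inl rfl, hqx⟩
      · exact ⟨Or.inr ⟨h, h''⟩, h'⟩
  rw [hR₁L] at h1
  rw [hR₂L, ← heq] at h2
  exact h1.trans (hli _ hsm) h2.symm

end Columns

/-! ### The equivalence in each order and the corollary -/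

theorem isVariationBounding_pred_iff {n m k : ℕ} (hk : 1 ≤ k) (X : Matrix (Fin n) (Fin m) ℝ) :
    IsVariationBounding (k - 1) X ↔
      ∀ u : Fin m → ℝ, u ≠ 0 → variation u < k → variation (X.mulVec u) < k := by
  have h : ((k - 1 : ℕ) : ℤ) = k - 1 := by push_cast [hk]; ring
  simp only [IsVariationBounding, h, Int.le_sub_one_iff]

/-- A matrix of rank greater than `k` with any `k` columns independent is `(k - 1)`-variation
bounding if and only if it is `k`-sign consistent. -/
theorem isVariationBounding_pred_iff_isSignConsistent {n m k : ℕ} (hk : 1 ≤ k)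
    (X : Matrix (Fin n) (Fin m) ℝ) (hrank : k < X.rank)
    (hli : ∀ J : Fin k → Fin m, StrictMono J → LinearIndependent ℝ (X.col ∘ J)) :
    IsVariationBounding (k - 1) X ↔ IsSignConsistent k X := by
  rw [isVariationBounding_pred_iff hk]
  constructor
  · intro h
    have hX : ∀ u, ¬ HasAlternation k u → ¬ HasAlternation k (X.mulVec u) := by
      intro u hu
      by_cases hu0 : u = 0
      · rw [hu0, Matrix.mulVec_zero]
        rintro ⟨σ, i, -, hi⟩
        simpa using hi 0
      · rw [← variation_lt_iff] at hu ⊢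
        exact h u hu0 hu
    have hagree := fun (I I' : Fin k ↪o Fin n) (J J' : Fin k ↪o Fin m) =>
      minorsAgree_of_bounding hX hrank hli J.strictMono J'.strictMono I I' I.strictMono
        I'.strictMono
    by_contra hcon
    simp only [IsSignConsistent, not_or, not_forall, not_le, compoundMatrix, Matrix.of_apply]
      at hcon
    obtain ⟨⟨I, J, h1⟩, I', J', h2⟩ := hcon
    exact absurd (hagree I I' J J') (not_le.2 (mul_neg_of_neg_of_pos h1 h2))
  · intro h
    obtain ⟨ε, hε, hs⟩ : ∃ ε : ℝ, ε ≠ 0 ∧ ∀ (I : Fin k → Fin n) (J : Fin k → Fin m),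
        StrictMono I → StrictMono J → 0 ≤ ε * (X.submatrix I J).det := by
      rcases h with h | h
      · refine ⟨1, one_ne_zero, fun I J hI hJ => ?_⟩
        have := h (OrderEmbedding.ofStrictMono I hI) (OrderEmbedding.ofStrictMono J hJ)
        simpa [compoundMatrix] using this
      · refine ⟨-1, by norm_num, fun I J hI hJ => ?_⟩
        have := h (OrderEmbedding.ofStrictMono I hI) (OrderEmbedding.ofStrictMono J hJ)
        simpa [compoundMatrix] using this
    refine variation_mulVec_lt_of_minors hk (hrank.le.trans X.rank_le_width) X ε hs
      fun J hJ => ?_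
    obtain ⟨I, hI, hne⟩ := Matrix.exists_minor_ne_zero (Y := X.submatrix id J) (hli J hJ)
    rw [Matrix.submatrix_submatrix] at hne
    exact ⟨I, hI, mul_ne_zero hε hne⟩

theorem mainTheorem12 {n m : ℕ} (k : ℕ) (hk : 1 ≤ k) (X : Matrix (Fin n) (Fin m) ℝ)
    (hrank : k < X.rank)
    (hcols : ∀ J : Finset (Fin m), J.card = k →
      LinearIndependent ℝ (fun j : J => X.col (j : Fin m))) :
    IsVariationDiminishing (k - 1) X ↔ IsSignRegular k X := by
  have key : ∀ j, 1 ≤ j → j ≤ k → (IsVariationBounding (j - 1) X ↔ IsSignConsistent j X) := by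
    intro j hj hjk
    refine isVariationBounding_pred_iff_isSignConsistent hj X (by omega) fun J hJ => ?_
    obtain ⟨T, hT, hTk⟩ := Finset.exists_superset_card_eq (s := Finset.univ.image J) (n := k)
      (by rwa [Finset.card_image_of_injective _ hJ.injective, Finset.card_univ, Fintype.card_fin])
      (by rw [Fintype.card_fin]; exact hrank.le.trans X.rank_le_width)
    have h1 : LinearIndepOn ℝ X.col (T : Set (Fin m)) := hcols T hTk
    rw [← linearIndepOn_range_iff hJ.injective]
    refine h1.mono ?_
    rintro _ ⟨i, rfl⟩
    exact hT (Finset.mem_image_of_mem _ (Finset.mem_univ i))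
  constructor
  · intro h j hj hjk
    exact (key j hj hjk).1 (h (j - 1) (by omega))
  · intro h j hj
    have := (key (j + 1) (by omega) (by omega)).2 (h (j + 1) (by omega) (by omega))
    simpa using this
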